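/- Let $k \geq 1$ be an integer and let $M$ be a positive real number. Then there exists an integer $d$ such that $d+i > 0$ for all $i = 1, \ldots, k$, the fields $\mathbb{Q}(\sqrt{d+1}), \ldots, \mathbb{Q}(\sqrt{d+k})$ are $k$ pairwise distinct real quadratic fields (each of degree $2$ over $\mathbb{Q}$), and $h(d+i) > M$ for all $i = 1, \ldots, k$, where $h(m)$ denotes the class number of the field $\mathbb{Q}(\sqrt{m})$, that is, the order of the ideal class group of its ring of integers. -/

import Mathlib

/-- The field `ℚ(√m)`, as a subfield of `ℝ`. It is meant for `m ≥ 0`, where `Real.sqrt m` is the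
genuine square root. -/
noncomputable def realQuadField (m : ℤ) : IntermediateField ℚ ℝ :=
  IntermediateField.adjoin ℚ {Real.sqrt (m : ℝ)}

theorem isIntegral_real_sqrt_intCast (m : ℤ) : IsIntegral ℚ (Real.sqrt (m : ℝ)) := by
  refine IsIntegral.of_pow (n := 2) two_pos ?_
  rcases le_total (m : ℝ) 0 with h | h
  · rw [Real.sqrt_eq_zero_of_nonpos h]
    simpa using isIntegral_zero
  · rw [Real.sq_sqrt h]
    simpa using isIntegral_algebraMap (R := ℚ) (A := ℝ) (x := (m : ℚ))

instance realQuadField_numberField (m : ℤ) : NumberField (realQuadField m) where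
  to_charZero := inferInstance
  to_finiteDimensional :=
    IntermediateField.adjoin.finiteDimensional (isIntegral_real_sqrt_intCast m)

/-- `h(m)`, the class number of `ℚ(√m)`. -/
noncomputable def realQuadClassNumber (m : ℤ) : ℕ :=
  NumberField.classNumber (realQuadField m)

open NumberField

/-! By the Chinese remainder theorem there is a run `d + 1, …, d + k` in which every term is exactly
divisible by many primes larger than `k`. Such a prime divides only one term, so the fields are
distinct. If `p` exactly divides `m`, then `(p, √m)² = (p)`. For a set `T` of such primes put `N_T =
∏ p` and `J_T = ∏ (p, √m)`, so `J_T² = (N_T)`. If `J_S` and `J_T` lie in one class, then `J_S J_T =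
(α)` and `N_S N_T = α² u` with `u` a unit. In a real quadratic field units have at most four classes
modulo squares. If `T`, `T'` share the class of `J_S` and their units agree modulo squares, then
`N_T N_T'` is a square in `ℚ(√m)`, so it or its product with `m` is a square in `ℕ`. A spare prime
`q` outside `T ∪ T'` exactly dividing `m` excludes the latter, whence `T = T'`. So `2 ^ n ≤ 4 h(m)`.
-/

/-- A natural number that some prime divides exactly once is not a square. -/
theorem not_isSquare_of_prime_dvd_of_not_sq_dvd {p n : ℕ} (hp : p.Prime) (h : p ∣ n)
    (h2 : ¬ p ^ 2 ∣ n) : ¬ IsSquare n := by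
  rintro ⟨r, rfl⟩
  have hr : p ∣ r := (hp.dvd_mul.1 h).elim id id
  exact h2 (by rw [pow_two]; exact mul_dvd_mul hr hr)

/-- If `p` divides `a` exactly once and does not divide `b`, then `a * b` is not a square. -/
theorem not_isSquare_mul_of_prime {p a b : ℕ} (hp : p.Prime) (ha : p ∣ a) (ha2 : ¬ p ^ 2 ∣ a)
    (hb : ¬ p ∣ b) : ¬ IsSquare (a * b) := by
  refine not_isSquare_of_prime_dvd_of_not_sq_dvd hp (ha.mul_right b) fun h => ha2 ?_
  exact (Nat.Coprime.pow_left 2 ((Nat.Prime.coprime_iff_not_dvd hp).2 hb)).dvd_of_dvd_mul_right h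

section PrimeProducts

variable {T T' : Finset ℕ}

theorem prime_dvd_prod_primes_iff (hT : ∀ p ∈ T, p.Prime) {q : ℕ} (hq : q.Prime) :
    q ∣ ∏ p ∈ T, p ↔ q ∈ T := by
  rw [hq.prime.dvd_finsetProd_iff]
  constructor
  · rintro ⟨p, hp, h⟩
    rwa [(Nat.prime_dvd_prime_iff_eq hq (hT p hp)).1 h]
  · exact fun h => ⟨q, h, dvd_rfl⟩

theorem not_sq_dvd_prod_primes (hT : ∀ p ∈ T, p.Prime) {q : ℕ} (hq : q.Prime) :
    ¬ q ^ 2 ∣ ∏ p ∈ T, p := by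
  intro h
  have hqT : q ∈ T := (prime_dvd_prod_primes_iff hT hq).1 ((dvd_pow_self q two_ne_zero).trans h)
  rw [← Finset.mul_prod_erase T (fun p => p) hqT, pow_two] at h
  have h' := Nat.dvd_of_mul_dvd_mul_left hq.pos h
  rw [prime_dvd_prod_primes_iff (fun p hp => hT p (Finset.mem_of_mem_erase hp)) hq] at h'
  exact Finset.notMem_erase q T h'

/-- A prime lying in only one of the two sets would divide the product exactly once. -/
theorem eq_of_isSquare_prod_primes_mul_prod_primes (hT : ∀ p ∈ T, p.Prime)
    (hT' : ∀ p ∈ T', p.Prime) (h : IsSquare ((∏ p ∈ T, p) * ∏ p ∈ T', p)) : T = T' := by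
  have key : ∀ U U' : Finset ℕ, (∀ p ∈ U, p.Prime) → (∀ p ∈ U', p.Prime) →
      IsSquare ((∏ p ∈ U, p) * ∏ p ∈ U', p) → U ⊆ U' := by
    intro U U' hU hU' h p hp
    by_contra hp'
    refine not_isSquare_mul_of_prime (hU p hp) ?_ (not_sq_dvd_prod_primes hU (hU p hp)) ?_ h
    · exact (prime_dvd_prod_primes_iff hU (hU p hp)).2 hp
    · rwa [prime_dvd_prod_primes_iff hU' (hU p hp)]
  exact (key T T' hT hT' h).antisymm (key T' T hT' hT (by rwa [mul_comm]))

end PrimeProducts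

/-! ### Ramified primes and 2-torsion in the class group -/

section RamifiedIdeals

/-- If `s² = m` and `m = p * c` with `p`, `c` coprime, then `(p, s)² = (p)`. -/
theorem span_pair_mul_self_eq_span_singleton {R : Type*} [CommRing R] {s : R} {p c : ℕ}
    (hs : s * s = ((p * c : ℕ) : R)) (hpc : Nat.Coprime p c) :
    Ideal.span {(p : R), s} * Ideal.span {(p : R), s} = Ideal.span {(p : R)} := by
  rw [Ideal.span_pair_mul_span_pair, hs]
  apply le_antisymm
  · rw [Ideal.span_le]
    rintro x (rfl | rfl | rfl | rfl) <;>
      simp only [SetLike.mem_coe, Ideal.mem_span_singleton]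
    · exact dvd_mul_right _ _
    · exact dvd_mul_right _ _
    · exact dvd_mul_left _ _
    · push_cast
      exact dvd_mul_right _ _
  · rw [Ideal.span_singleton_le_iff_mem]
    -- Multiplying Bézout's identity by `p` writes `p` in terms of the generators `p²` and `s² =
    -- pc`.
    obtain ⟨u, v, huv⟩ := Nat.isCoprime_iff_coprime.2 hpc
    have huv' : (u : R) * p + v * c = 1 := by exact_mod_cast congrArg (Int.cast : ℤ → R) huv
    have : (p : R) = u * ((p : R) * p) + v * ((p * c : ℕ) : R) := by
      push_cast
      linear_combination -(p : R) * huv'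
    refine (congrArg (· ∈ _) this).mpr <| Ideal.add_mem _ (Ideal.mul_mem_left _ _ (Ideal.subset_span ?_))
      (Ideal.mul_mem_left _ _ (Ideal.subset_span ?_)) <;> simp

theorem coprime_div_of_not_sq_dvd {p m : ℕ} (hp : p.Prime) (h : p ∣ m) (h2 : ¬ p ^ 2 ∣ m) :
    Nat.Coprime p (m / p) := by
  rw [Nat.Prime.coprime_iff_not_dvd hp]
  intro hd
  apply h2
  rw [pow_two]
  exact (Nat.dvd_div_iff_mul_dvd h).1 hd

/-- Genus-theoretic lower bound: if the primes in `A` exactly divide a square `m = s²` of the ring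
of integers, the units modulo squares are separated by a map to a finite type `C`, and products of
primes in `A` are distinguished modulo squares of `K`, then `2 ^ #A ≤ #C * h(K)`. -/
theorem two_pow_card_le_card_mul_classNumber (K : Type*) [Field K] [NumberField K]
    {s : 𝓞 K} {m : ℕ} (hs : s * s = (m : 𝓞 K)) {A : Finset ℕ}
    (hA : ∀ p ∈ A, p.Prime ∧ p ∣ m ∧ ¬ p ^ 2 ∣ m)
    {C : Type*} [Fintype C] (c : (𝓞 K)ˣ → C) (hc : ∀ u v, c u = c v → IsSquare (u * v))
    (hsq : ∀ T ⊆ A, ∀ T' ⊆ A,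
      IsSquare ((((∏ p ∈ T, p) * ∏ p ∈ T', p : ℕ)) : K) → T = T') :
    2 ^ A.card ≤ Fintype.card C * classNumber K := by
  classical
  set J : Finset ℕ → Ideal (𝓞 K) := fun T => ∏ p ∈ T, Ideal.span {(p : 𝓞 K), s} with hJ
  have hJJ : ∀ T ⊆ A, J T * J T = Ideal.span {((∏ p ∈ T, p : ℕ) : 𝓞 K)} := by
    intro T hT
    rw [hJ]
    simp only
    rw [← Finset.prod_mul_distrib, Nat.cast_prod, ← Ideal.prod_span_singleton]
    refine Finset.prod_congr rfl fun p hp => ?_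
    obtain ⟨hpp, hpm, hpm2⟩ := hA p (hT hp)
    refine span_pair_mul_self_eq_span_singleton (c := m / p) ?_
      (coprime_div_of_not_sq_dvd hpp hpm hpm2)
    rw [Nat.mul_div_cancel' hpm, hs]
  have hN : ∀ T ⊆ A, (∏ p ∈ T, p) ≠ 0 := fun T hT =>
    Finset.prod_ne_zero_iff.2 fun p hp => (hA p (hT hp)).1.ne_zero
  have hJ0 : ∀ T : Finset ℕ, T ⊆ A → J T ≠ 0 := by
    intro T hT h
    have := hJJ T hT
    rw [h, zero_mul, eq_comm, Ideal.zero_eq_bot, Ideal.span_singleton_eq_bot] at this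
    exact hN T hT (by exact_mod_cast this)
  set f : Finset ℕ → ClassGroup (𝓞 K) := fun T =>
    if h : J T ≠ 0 then ClassGroup.mk0 ⟨J T, mem_nonZeroDivisors_of_ne_zero h⟩ else 1 with hf
  have hprinc : ∀ S ⊆ A, ∀ T ⊆ A, f T = f S →
      ∃ α : 𝓞 K, ∃ u : (𝓞 K)ˣ,
        α * α * u = ((∏ p ∈ S, p : ℕ) : 𝓞 K) * ((∏ p ∈ T, p : ℕ) : 𝓞 K) := by
    intro S hS T hT hTS
    -- The class of `J S` is its own inverse, so equal classes make `J S * J T` principal.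
    have hfS : f S * f S = 1 := by
      simp only [hf, dif_pos (hJ0 S hS), ← map_mul]
      rw [show (⟨J S, mem_nonZeroDivisors_of_ne_zero (hJ0 S hS)⟩ : nonZeroDivisors (Ideal (𝓞 K))) *
        ⟨J S, mem_nonZeroDivisors_of_ne_zero (hJ0 S hS)⟩ = ⟨J S * J S,
          mem_nonZeroDivisors_of_ne_zero (mul_ne_zero (hJ0 S hS) (hJ0 S hS))⟩ from rfl,
        ClassGroup.mk0_eq_one_iff, hJJ S hS]
      exact ⟨⟨_, rfl⟩⟩
    have hST : f S * f T = 1 := by rw [hTS, hfS]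
    simp only [hf, dif_pos (hJ0 S hS), dif_pos (hJ0 T hT), ← map_mul] at hST
    rw [show (⟨J S, mem_nonZeroDivisors_of_ne_zero (hJ0 S hS)⟩ : nonZeroDivisors (Ideal (𝓞 K))) *
        ⟨J T, mem_nonZeroDivisors_of_ne_zero (hJ0 T hT)⟩ = ⟨J S * J T,
          mem_nonZeroDivisors_of_ne_zero (mul_ne_zero (hJ0 S hS) (hJ0 T hT))⟩ from rfl,
        ClassGroup.mk0_eq_one_iff] at hST
    obtain ⟨⟨α, hα⟩⟩ := hST
    refine ⟨α, ?_⟩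
    change J S * J T = Ideal.span {α} at hα
    have : Ideal.span {α * α} =
        Ideal.span {((∏ p ∈ S, p : ℕ) : 𝓞 K) * ((∏ p ∈ T, p : ℕ) : 𝓞 K)} := by
      rw [← Ideal.span_singleton_mul_span_singleton, ← Ideal.span_singleton_mul_span_singleton,
        ← hα, ← hJJ S hS, ← hJJ T hT, mul_mul_mul_comm]
    exact Ideal.span_singleton_eq_span_singleton.1 this
  have hfiber : ∀ b ∈ A.powerset.image f,
      (A.powerset.filter fun T => f T = b).card ≤ Fintype.card C := by
    intro b hb
    obtain ⟨S, hS, rfl⟩ := Finset.mem_image.1 hb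
    rw [Finset.mem_powerset] at hS
    have hex : ∀ T, ∃ u : (𝓞 K)ˣ, T ⊆ A → f T = f S → ∃ α : 𝓞 K,
        α * α * u = ((∏ p ∈ S, p : ℕ) : 𝓞 K) * ((∏ p ∈ T, p : ℕ) : 𝓞 K) := by
      intro T
      by_cases h : T ⊆ A ∧ f T = f S
      · obtain ⟨α, u, hu⟩ := hprinc S hS T h.1 h.2
        exact ⟨u, fun _ _ => ⟨α, hu⟩⟩
      · exact ⟨1, fun h1 h2 => absurd ⟨h1, h2⟩ h⟩
    choose u hu using hex
    rw [← Finset.card_univ]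
    refine Finset.card_le_card_of_injOn (fun T => c (u T))
      (fun _ _ => Finset.mem_coe.2 (Finset.mem_univ _)) ?_
    intro T hT T' hT' hTT'
    simp only [Finset.coe_filter, Finset.mem_powerset, Set.mem_ofPred_eq] at hT hT'
    obtain ⟨α, hα⟩ := hu T hT.1 hT.2
    obtain ⟨β, hβ⟩ := hu T' hT'.1 hT'.2
    obtain ⟨w, hw⟩ := hc _ _ hTT'
    have hw' : (u T : 𝓞 K) * (u T' : 𝓞 K) = w * w := by exact_mod_cast congrArg Units.val hw
    -- Multiplying the relations for `T` and `T'` gives `N_S² N_T N_T' = (αβw)²`.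
    refine hsq T hT.1 T' hT'.1 ⟨(α * β * w : 𝓞 K) / ((∏ p ∈ S, p : ℕ) : K), ?_⟩
    have hS0 : ((∏ p ∈ S, p : ℕ) : K) ≠ 0 := by exact_mod_cast hN S hS
    have hO : ((∏ p ∈ S, p : ℕ) : 𝓞 K) * ((∏ p ∈ S, p : ℕ) : 𝓞 K) *
        (((∏ p ∈ T, p : ℕ) : 𝓞 K) * ((∏ p ∈ T', p : ℕ) : 𝓞 K)) =
        (α * β * w) * (α * β * w) := by
      linear_combination (-((∏ p ∈ S, p : ℕ) : 𝓞 K) * ((∏ p ∈ T', p : ℕ) : 𝓞 K)) * hα -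
        α * α * u T * hβ + α * α * β * β * hw'
    have hK := congrArg (algebraMap (𝓞 K) K) hO
    simp only [map_mul, map_natCast] at hK
    rw [div_mul_div_comm, eq_div_iff (mul_ne_zero hS0 hS0), Nat.cast_mul]
    simp only [map_mul]
    linear_combination hK
  calc 2 ^ A.card = A.powerset.card := (Finset.card_powerset A).symm
    _ ≤ Fintype.card C * (A.powerset.image f).card := Finset.card_le_mul_card_image _ _ hfiber
    _ ≤ Fintype.card C * classNumber K := Nat.mul_le_mul_left _ (Finset.card_le_univ _)

end RamifiedIdeals

/-! ### Units modulo squares -/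

/-- The units of a real number field modulo squares are separated by a sign and the parities of the
exponents of a fundamental system. -/
theorem exists_units_classifier_mod_squares (K : IntermediateField ℚ ℝ) [NumberField K] :
    ∃ c : (𝓞 K)ˣ → Bool × (Fin (Units.rank K) → ZMod 2),
      ∀ u v, c u = c v → IsSquare (u * v) := by
  classical
  have hex := fun x : (𝓞 K)ˣ => (Units.exist_unique_eq_mul_prod K x).exists
  choose ζe hζe using hex
  -- Since `K` lies in `ℝ`, a root of unity has absolute value 1 and is `±1`.
  have htors : ∀ ζ : Units.torsion K, (ζ : (𝓞 K)ˣ) = 1 ∨ (ζ : (𝓞 K)ˣ) = -1 := by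
    rintro ⟨ζ, hζ⟩
    obtain ⟨n, hn, h⟩ := isOfFinOrder_iff_pow_eq_one.1 ((CommGroup.mem_torsion _).1 hζ)
    have h1 : (((ζ : 𝓞 K) : K) : ℝ) ^ n = 1 := by
      have := congrArg (fun x : (𝓞 K)ˣ => (((x : 𝓞 K) : K) : ℝ)) h
      simpa using this
    have h2 : |(((ζ : 𝓞 K) : K) : ℝ)| = 1 := by
      rw [← pow_eq_one_iff_of_nonneg (abs_nonneg _) hn.ne', ← abs_pow, h1, abs_one]
    rcases eq_or_eq_neg_of_abs_eq h2 with h3 | h3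
    · left
      ext
      simpa using h3
    · right
      ext
      simpa using h3
  refine ⟨fun u => (decide (((ζe u).1 : (𝓞 K)ˣ) = 1), fun i => ((ζe u).2 i : ZMod 2)), ?_⟩
  intro u v huv
  simp only [Prod.mk.injEq, decide_eq_decide] at huv
  obtain ⟨h1, h2⟩ := huv
  have hζ : ((ζe u).1 : (𝓞 K)ˣ) * ((ζe v).1 : (𝓞 K)ˣ) = 1 := by
    rcases htors (ζe u).1 with h | h
    · rw [h, h1.1 h, one_mul]
    · rcases htors (ζe v).1 with h' | h'
      · rw [h', h1.2 h', one_mul]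
      · rw [h, h', neg_mul_neg, one_mul]
  have hev : ∀ i, ∃ r, (ζe u).2 i + (ζe v).2 i = r + r := by
    intro i
    have h := congrFun h2 i
    have h' : (((ζe u).2 i + (ζe v).2 i : ℤ) : ZMod 2) = 0 := by
      push_cast
      rw [h]
      exact CharTwo.add_self_eq_zero _
    rw [ZMod.intCast_zmod_eq_zero_iff_dvd] at h'
    exact (even_iff_two_dvd.2 (by exact_mod_cast h'))
  choose r hr using hev
  refine ⟨∏ i, Units.fundSystem K i ^ r i, ?_⟩
  rw [hζe u, hζe v, mul_mul_mul_comm, hζ, one_mul, ← Finset.prod_mul_distrib,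
    ← Finset.prod_mul_distrib]
  refine Finset.prod_congr rfl fun i _ => ?_
  rw [← zpow_add, ← zpow_add, hr]

/-- The rank is `r₁ + r₂ - 1` and the degree is `r₁ + 2 r₂`. A quadratic field thus has rank at most
1. -/
theorem units_rank_lt_finrank (K : Type*) [Field K] [NumberField K] :
    Units.rank K < Module.finrank ℚ K := by
  have h1 := InfinitePlace.card_eq_nrRealPlaces_add_nrComplexPlaces K
  have h2 := InfinitePlace.card_add_two_mul_card_eq_rank K
  have h3 : 0 < Module.finrank ℚ K := Module.finrank_pos
  unfold Units.rank
  omega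

/-! ### Real quadratic fields -/

section RealQuadratic

variable {m : ℕ}

theorem finrank_realQuadField (hm : ¬ IsSquare m) :
    Module.finrank ℚ (realQuadField m) = 2 := by
  have hirr : Irreducible (Polynomial.X ^ 2 - Polynomial.C (m : ℚ)) := by
    refine X_pow_sub_C_irreducible_of_prime Nat.prime_two fun b hb => hm ?_
    rw [← Rat.isSquare_natCast_iff]
    exact ⟨b, by rw [← hb, pow_two]⟩
  have hmin := minpoly.eq_of_irreducible_of_monic (x := Real.sqrt ((m : ℤ) : ℝ)) hirr (by simp)
    (Polynomial.monic_X_pow_sub_C _ two_ne_zero)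
  have h := IntermediateField.adjoin.finrank (isIntegral_real_sqrt_intCast m)
  rw [← hmin, Polynomial.natDegree_X_pow_sub_C] at h
  exact h

theorem exists_rat_of_mem_realQuadField {x : ℝ} (hx : x ∈ realQuadField m) :
    ∃ a b : ℚ, x = a + b * Real.sqrt m := by
  have hx' : x ∈ Algebra.adjoin ℚ {Real.sqrt ((m : ℤ) : ℝ)} := by
    rw [← IntermediateField.adjoin_simple_toSubalgebra_of_isAlgebraic
      (isIntegral_real_sqrt_intCast m).isAlgebraic]
    exact hx
  clear hx
  induction hx' using Algebra.adjoin_induction with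
  | mem x hx =>
    rw [Set.mem_singleton_iff] at hx
    exact ⟨0, 1, by simp [hx]⟩
  | algebraMap r => exact ⟨r, 0, by simp⟩
  | add x y _ _ hx hy =>
    obtain ⟨a, b, rfl⟩ := hx
    obtain ⟨a', b', rfl⟩ := hy
    exact ⟨a + a', b + b', by push_cast; ring⟩
  | mul x y _ _ hx hy =>
    obtain ⟨a, b, rfl⟩ := hx
    obtain ⟨a', b', rfl⟩ := hy
    refine ⟨a * a' + b * b' * m, a * b' + a' * b, ?_⟩
    push_cast
    linear_combination (b * b' : ℝ) * Real.mul_self_sqrt (Nat.cast_nonneg (α := ℝ) m)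

/-- A natural number that is a square in `ℚ(√m)` is a square or becomes one after multiplication
by `m`. -/
theorem isSquare_or_isSquare_mul_of_sq_mem_realQuadField (hm : ¬ IsSquare m) {n : ℕ} {x : ℝ}
    (hx : x ∈ realQuadField m) (hxn : x * x = n) : IsSquare n ∨ IsSquare (n * m) := by
  obtain ⟨a, b, rfl⟩ := exists_rat_of_mem_realQuadField hx
  have hss := Real.mul_self_sqrt (Nat.cast_nonneg (α := ℝ) m)
  have hlin : ((a * a + b * b * m - n : ℚ) : ℝ) + ((2 * a * b : ℚ) : ℝ) * Real.sqrt m = 0 := by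
    push_cast
    linear_combination hxn - (b * b : ℝ) * hss
  have hirr : Irrational (Real.sqrt m) := irrational_sqrt_natCast_iff.2 hm
  have hab : 2 * a * b = 0 := by
    by_contra h
    refine hirr ⟨-(a * a + b * b * m - n) / (2 * a * b), ?_⟩
    have h' : ((2 * a * b : ℚ) : ℝ) ≠ 0 := by exact_mod_cast h
    rw [Rat.cast_div, div_eq_iff h', Rat.cast_neg]
    linear_combination -hlin
  rw [hab, Rat.cast_zero, zero_mul, add_zero, Rat.cast_eq_zero] at hlin
  rcases mul_eq_zero.1 hab with h | h
  · have ha : a = 0 := by simpa using h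
    right
    rw [← Rat.isSquare_natCast_iff]
    refine ⟨b * m, ?_⟩
    push_cast
    rw [ha] at hlin
    linear_combination -(m : ℚ) * hlin
  · left
    rw [← Rat.isSquare_natCast_iff]
    refine ⟨a, ?_⟩
    rw [h] at hlin
    linear_combination -hlin

theorem sqrt_mem_realQuadField (m : ℕ) : Real.sqrt m ∈ realQuadField m := by
  have h := IntermediateField.mem_adjoin_simple_self ℚ (Real.sqrt ((m : ℤ) : ℝ))
  rwa [Int.cast_natCast] at h

theorem realQuadField_ne_of_prime {n p : ℕ} (hn : ¬ IsSquare n) (hp : p.Prime) (hm : p ∣ m)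
    (hm2 : ¬ p ^ 2 ∣ m) (hpn : ¬ p ∣ n) : realQuadField m ≠ realQuadField n := by
  intro h
  have hmem : Real.sqrt m ∈ realQuadField n := h ▸ sqrt_mem_realQuadField m
  rcases isSquare_or_isSquare_mul_of_sq_mem_realQuadField hn hmem
    (Real.mul_self_sqrt (Nat.cast_nonneg (α := ℝ) m)) with h | h
  · exact not_isSquare_of_prime_dvd_of_not_sq_dvd hp hm hm2 h
  · exact not_isSquare_mul_of_prime hp hm hm2 hpn h

/-- If the primes in `A` and a further prime `q` divide `m` exactly once, then the class number of
`ℚ(√m)` is at least `2 ^ #A / 4`. -/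
theorem two_pow_card_le_four_mul_realQuadClassNumber {A : Finset ℕ} {q : ℕ}
    (hA : ∀ p ∈ A, p.Prime ∧ p ∣ m ∧ ¬ p ^ 2 ∣ m) (hq : q.Prime) (hqm : q ∣ m)
    (hqm2 : ¬ q ^ 2 ∣ m) (hqA : q ∉ A) : 2 ^ A.card ≤ 4 * realQuadClassNumber m := by
  have hm : ¬ IsSquare m := not_isSquare_of_prime_dvd_of_not_sq_dvd hq hqm hqm2
  obtain ⟨c, hc⟩ := exists_units_classifier_mod_squares (realQuadField m)
  have hint : IsIntegral ℤ (⟨Real.sqrt m, sqrt_mem_realQuadField m⟩ : realQuadField m) := by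
    refine IsIntegral.of_pow (n := 2) two_pos ?_
    have : (⟨Real.sqrt m, sqrt_mem_realQuadField m⟩ : realQuadField m) ^ 2 = (m : ℤ) := by
      ext
      simp
    rw [this]
    exact isIntegral_algebraMap (R := ℤ) (x := (m : ℤ))
  obtain ⟨s, hs'⟩ : ∃ s : 𝓞 (realQuadField m),
      algebraMap (𝓞 (realQuadField m)) (realQuadField m) s =
        ⟨Real.sqrt m, sqrt_mem_realQuadField m⟩ := ⟨⟨_, hint⟩, rfl⟩
  have hs : s * s = (m : 𝓞 (realQuadField m)) := by
    apply FaithfulSMul.algebraMap_injective (𝓞 (realQuadField m)) (realQuadField m)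
    rw [map_mul, map_natCast, hs']
    ext
    simp
  have hrank : Units.rank (realQuadField m) ≤ 1 := by
    have := units_rank_lt_finrank (realQuadField m)
    rw [finrank_realQuadField hm] at this
    omega
  have hcard : Fintype.card (Bool × (Fin (Units.rank (realQuadField m)) → ZMod 2)) ≤ 4 := by
    rw [Fintype.card_prod, Fintype.card_bool, Fintype.card_fun, ZMod.card, Fintype.card_fin]
    calc 2 * 2 ^ Units.rank (realQuadField m) ≤ 2 * 2 ^ 1 := by gcongr; norm_num
      _ = 4 := by norm_num
  refine (two_pow_card_le_card_mul_classNumber (realQuadField m) hs hA c hc ?_).trans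
    (Nat.mul_le_mul_right _ hcard)
  rintro T hT T' hT' ⟨x, hx⟩
  have hTp : ∀ p ∈ T, p.Prime := fun p hp => (hA p (hT hp)).1
  have hTp' : ∀ p ∈ T', p.Prime := fun p hp => (hA p (hT' hp)).1
  have hx' : (x : ℝ) * x = (((∏ p ∈ T, p) * ∏ p ∈ T', p : ℕ) : ℝ) := by
    have := congrArg (fun y : realQuadField m => (y : ℝ)) hx
    simpa using this.symm
  rcases isSquare_or_isSquare_mul_of_sq_mem_realQuadField hm x.2 hx' with h | h
  · exact eq_of_isSquare_prod_primes_mul_prod_primes hTp hTp' h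
  · rw [mul_comm] at h
    refine absurd h (not_isSquare_mul_of_prime hq hqm hqm2 fun hd => ?_)
    rcases hq.dvd_mul.1 hd with hd | hd
    · exact hqA (hT ((prime_dvd_prod_primes_iff hTp hq).1 hd))
    · exact hqA (hT' ((prime_dvd_prod_primes_iff hTp' hq).1 hd))

end RealQuadratic

/-! ### Construction of the run and conclusion -/

/-- There is a run of `k` consecutive integers `d + 1, …, d + k`, each exactly divisible by `n`
primes larger than `k`. -/
theorem exists_consecutive_exactly_divisible (k n : ℕ) :
    ∃ d : ℕ, ∃ P : ℕ → ℕ → ℕ, ∀ i ∈ Finset.Icc 1 k, Set.InjOn (P i) (Finset.range n) ∧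
      ∀ j ∈ Finset.range n, (P i j).Prime ∧ k < P i j ∧ P i j ∣ d + i ∧ ¬ P i j ^ 2 ∣ d + i := by
  -- Pairing makes the primes distinct for distinct `(i, j)`; the shift by `k` makes them exceed
  -- `k`.
  let Q : ℕ × ℕ → ℕ := fun t => Nat.nth Nat.Prime (k + Nat.pair t.1 t.2)
  have hQ : ∀ t, (Q t).Prime := fun t => Nat.prime_nth_prime _
  have hQinj : Function.Injective Q := by
    rintro ⟨a, b⟩ ⟨a', b'⟩ h
    have h' := Nat.nth_injective Nat.infinite_setOfPred_prime h
    rw [add_right_inj, Nat.pair_eq_pair] at h'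
    exact Prod.ext h'.1 h'.2
  have hQk : ∀ t, k < Q t := fun t => by
    have := Nat.add_two_le_nth_prime (k + Nat.pair t.1 t.2)
    change k < Nat.nth Nat.Prime (k + Nat.pair t.1 t.2)
    omega
  -- The residue gives `d + i ≡ Q (i, j)` modulo `Q (i, j) ^ 2`, hence exact divisibility; the
  -- subtraction does not truncate since `i ≤ k < Q (i, j)`.
  obtain ⟨d, hd⟩ := Nat.chineseRemainderOfFinset (fun t => Q t - t.1) (fun t => Q t ^ 2)
    (Finset.Icc 1 k ×ˢ Finset.range n) (fun t _ => pow_ne_zero 2 (hQ t).ne_zero)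
    (fun t _ t' _ h => Nat.Coprime.pow 2 2
      ((Nat.coprime_primes (hQ t) (hQ t')).2 (hQinj.ne h)))
  refine ⟨d, fun i j => Q (i, j), fun i hi => ⟨fun j _ j' _ h => ?_, fun j hj => ?_⟩⟩
  · exact congrArg Prod.snd (hQinj h)
  have hmod : d + i ≡ Q (i, j) [MOD Q (i, j) ^ 2] := by
    have h := (hd (i, j) (Finset.mem_product.2 ⟨hi, hj⟩)).add_right i
    have hik : i ≤ Q (i, j) := (Finset.mem_Icc.1 hi).2.trans (hQk (i, j)).le
    simpa only [Nat.sub_add_cancel hik] using h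
  refine ⟨hQ _, hQk _, ?_, ?_⟩
  · exact ((hmod.of_dvd (dvd_pow_self _ two_ne_zero)).dvd_iff dvd_rfl).2 dvd_rfl
  · rw [hmod.dvd_iff dvd_rfl]
    intro h
    have h1 := Nat.le_of_dvd (hQ (i, j)).pos h
    have h2 := (hQ (i, j)).two_le
    nlinarith

theorem theorem5p3 (k : ℕ) (hk : 1 ≤ k) (M : ℝ) (hM : 0 < M) :
    ∃ d : ℤ,
      (∀ i ∈ Finset.Icc 1 k,
        0 < d + (i : ℤ) ∧ Module.finrank ℚ (realQuadField (d + (i : ℤ))) = 2) ∧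
      (∀ i ∈ Finset.Icc 1 k, ∀ j ∈ Finset.Icc 1 k, i ≠ j →
        realQuadField (d + (i : ℤ)) ≠ realQuadField (d + (j : ℤ))) ∧
      (∀ i ∈ Finset.Icc 1 k, M < (realQuadClassNumber (d + (i : ℤ)) : ℝ)) := by
  obtain ⟨n, hn⟩ := pow_unbounded_of_one_lt (4 * M) (one_lt_two (α := ℝ))
  -- Of the `n + 1` primes, `n` form the set `A` and the last is the spare prime `q`.
  obtain ⟨d, P, hP⟩ := exists_consecutive_exactly_divisible k (n + 1)
  have hlast : n ∈ Finset.range (n + 1) := Finset.self_mem_range_succ n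
  have hns : ∀ i ∈ Finset.Icc 1 k, ¬ IsSquare (d + i) := fun i hi =>
    have h := (hP i hi).2 n hlast
    not_isSquare_of_prime_dvd_of_not_sq_dvd h.1 h.2.2.1 h.2.2.2
  refine ⟨d, fun i hi => ⟨?_, ?_⟩, fun i hi j hj hij => ?_, fun i hi => ?_⟩
  · have := (Finset.mem_Icc.1 hi).1
    omega
  · exact_mod_cast finrank_realQuadField (hns i hi)
  · obtain ⟨hp, hpk, hpi, hpi2⟩ := (hP i hi).2 n hlast
    have hpj : ¬ P i n ∣ d + j := by
      intro hpj
      have h1 := Finset.mem_Icc.1 hi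
      have h2 := Finset.mem_Icc.1 hj
      have hmod : i ≡ j [MOD P i n] := Nat.ModEq.add_left_cancel' d
        ((Nat.modEq_zero_iff_dvd.2 hpi).trans (Nat.modEq_zero_iff_dvd.2 hpj).symm)
      exact hij (hmod.eq_of_lt_of_lt (by omega) (by omega))
    exact_mod_cast realQuadField_ne_of_prime (hns j hj) hp hpi hpi2 hpj
  · obtain ⟨hinj, hPi⟩ := hP i hi
    obtain ⟨hq, -, hqi, hqi2⟩ := hPi n hlast
    have hsub : Finset.range n ⊆ Finset.range (n + 1) := Finset.range_subset_range.2 n.le_succ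
    have hcard : ((Finset.range n).image (P i)).card = n := by
      rw [Finset.card_image_of_injOn (hinj.mono (Finset.coe_subset.2 hsub)), Finset.card_range]
    have hle := two_pow_card_le_four_mul_realQuadClassNumber (m := d + i)
      (A := (Finset.range n).image (P i)) (q := P i n)
      (fun p hp => by
        obtain ⟨j, hj, rfl⟩ := Finset.mem_image.1 hp
        have h := hPi j (hsub hj)
        exact ⟨h.1, h.2.2.1, h.2.2.2⟩) hq hqi hqi2
      (fun hmem => by
        obtain ⟨j, hj, h⟩ := Finset.mem_image.1 hmem
        have hjn := hinj (Finset.mem_coe.2 (hsub hj)) (Finset.mem_coe.2 hlast) h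
        exact (Finset.mem_range.1 hj).ne hjn)
    rw [hcard] at hle
    have hle' : (2 : ℝ) ^ n ≤ 4 * (realQuadClassNumber ((d + i : ℕ) : ℤ) : ℝ) := by
      exact_mod_cast hle
    rw [Nat.cast_add] at hle'
    linarith
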